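/- **Setting.** A network system $\Sigma$ consists of $n$ first-order subsystems with trivial internal dynamics, $\dot x_i=\sum_{j\neq i}a_{ij}x_j+b_iu$ with $x_i(t)\in\mathbb R$, $u(t)\in\mathbb R^m$, regarded as a structured system: a given set of weights $a_{ij}$ ($i\ne j$) and of entries $b_{i,s}$ are free real parameters and all others are zero. A structured system $\dot x=Ax+Bu$ with $N$ states is *structurally controllable* if for some choice of the free parameters the matrix $\mathcal R=[B\ AB\ \cdots\ A^{N-1}B]$ has full row rank. Its graph has the input components and the state components as nodes, with an edge from input $s$ to state $i$ if $B_{is}$ is free and from state $j$ to state $i$ if $A_{ij}$ is free. A *stem* is a sequence of distinct nodes, consecutive ones joined by edges, from an input node to a state node; a *cycle* is a sequence $v_1,\dots,v_\ell$ ($\ell\ge2$), consecutive nodes joined by edges, with $v_1=v_\ell$ and no other repetition. The system is *input-accessible* if every state node is the end of a stem. An *X-cover* is a finite set $\mathcal P$ of stems and cycles covering all state nodes, such that no two distinct stems of $\mathcal P$ start at the same input node, and $\mathcal P$ contains a stem and a cycle that intersect, or two distinct cycles that intersect, or two stems from different input nodes that intersect. $\Sigma$ is an *X-network* if it is input-accessible,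 not structurally controllable, and has an X-cover. An *extended system* $\hat\Sigma$ of $\Sigma$ replaces subsystem $i$ by one with $\hat n_i\ge1$ states, $\dot{\hat x}_i=\hat a_i\hat x_i+\sum_{j\ne i}\hat a_{ij}\hat x_j+\hat b_iu$, where each $\hat a_i$ is either a generic matrix or zero, each block $\hat a_{ij}$ ($i\neq j$) and each column $\hat b_{i,s}$ of $\hat b_i$ is either generic or zero, and they may be generic only if $a_{ij}$, respectively $b_{i,s}$, is free in $\Sigma$. It is *homogeneous* if $\hat a_i=0$ for all $i$. Its outputs are $\hat y_i=\hat c_i\hat x_i$, $i=1,\dots,n$, with $\hat c_i$ free if $\hat n_i>1$ and $\hat c_i=1$ if $\hat n_i=1$; with $\hat C$ the block diagonal matrix of the $\hat c_i$, $\hat\Sigma$ is *structurally output controllable* if $\hat C\hat{\mathcal R}$ has full row rank $n$ for some choice of the free parameters. **Theorem 2.** Let $\Sigma$ be an X-network. Then there is a homogeneous extended system $\hat\Sigma$ of $\Sigma$ that is structurally controllable and structurally output controllable. Moreover, let $\mathcal P$ be any X-cover of $\Sigma$, let $\hat n_i$ be the number of paths of $\mathcal P$ through the state node $i$, and let $\hat\Sigma$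 be the homogeneous extended system with these orders in which $\hat a_{ij}$ ($i\ne j$) and $\hat b_{i,s}$ are generic exactly when $a_{ij}$ and $b_{i,s}$ are free. Then $\hat n_i\geq 1$ for all $i$; each $p\in\mathcal P$ has a lift $\hat p$ in the graph of $\hat\Sigma$ (replacing every state node $i$ of $p$ by a state of subsystem $i$, and keeping the input nodes) that is a stem if $p$ is a stem and a cycle if $p$ is a cycle; the lifts of distinct paths are vertex-disjoint, and together they cover all state nodes of $\hat\Sigma$; and $\hat\Sigma$ is structurally controllable and structurally output controllable. -/

import Mathlib

/-- A structured linear system `x' = A x + B u` with states indexed by `ι` and inputs indexed by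
`κ`: it records which entries of `A` and `B` are free parameters; all other entries are zero. -/
structure StructuredSystem (ι κ : Type) where
  /-- the entry `A i j` is a free parameter -/
  freeA : ι → ι → Prop
  /-- the entry `B i s` is a free parameter -/
  freeB : ι → κ → Prop

/-- The controllability matrix `[B, A B, …, A ^ (N - 1) B]`, where `N` is the number of states. -/
def ctrbMatrix {ι κ : Type} [Fintype ι] [DecidableEq ι]
    (A : Matrix ι ι ℝ) (B : Matrix ι κ ℝ) : Matrix ι (Fin (Fintype.card ι) × κ) ℝ :=
  Matrix.of fun i c => (A ^ (c.1 : ℕ) * B) i c.2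

namespace StructuredSystem

variable {ι κ : Type}

/-- `(A, B)` is a numerical realization of the structured system. -/
def IsRealization (T : StructuredSystem ι κ) (A : Matrix ι ι ℝ) (B : Matrix ι κ ℝ) : Prop :=
  (∀ i j, ¬ T.freeA i j → A i j = 0) ∧ (∀ i s, ¬ T.freeB i s → B i s = 0)

/-- Some numerical realization has a controllability matrix of full row rank. -/
def StructurallyControllable [Fintype ι] [DecidableEq ι] [Fintype κ]
    (T : StructuredSystem ι κ) : Prop :=
  ∃ (A : Matrix ι ι ℝ) (B : Matrix ι κ ℝ),
    T.IsRealization A B ∧ (ctrbMatrix A B).rank = Fintype.card ι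

/-- The directed graph of the system: its nodes are the input nodes `Sum.inl s` and the state nodes
`Sum.inr i`; there is an edge from input `s` to state `i` when `B i s` is free, and an edge from
state `j` to state `i` when `A i j` is free. -/
def graph (T : StructuredSystem ι κ) : Digraph (κ ⊕ ι) where
  Adj
    | Sum.inl s, Sum.inr i => T.freeB i s
    | Sum.inr j, Sum.inr i => T.freeA i j
    | _, Sum.inl _ => False

/-- A stem: a sequence of distinct nodes, consecutive ones joined by edges, which starts at an input
node and ends at a state node. -/
def IsStem (T : StructuredSystem ι κ) (p : List (κ ⊕ ι)) : Prop :=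
  p.Nodup ∧ p.IsChain T.graph.Adj ∧
    (∃ s, p.head? = some (Sum.inl s)) ∧ (∃ i, p.getLast? = some (Sum.inr i))

/-- An elementary cycle: a sequence `v₁, …, v_ℓ` with at least one edge, consecutive nodes joined by
edges, `v₁ = v_ℓ`, and no other repetition. -/
def IsCycle (T : StructuredSystem ι κ) (p : List (κ ⊕ ι)) : Prop :=
  2 ≤ p.length ∧ p.tail.Nodup ∧ p.IsChain T.graph.Adj ∧ p.head? = p.getLast?

/-- Every state node is the end node of a stem. -/
def InputAccessible (T : StructuredSystem ι κ) : Prop :=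
  ∀ i, ∃ p, T.IsStem p ∧ p.getLast? = some (Sum.inr i)

/-- `P` is a set of stems and cycles that covers all the state nodes. -/
def IsCover (T : StructuredSystem ι κ) (P : Finset (List (κ ⊕ ι))) : Prop :=
  (∀ p ∈ P, T.IsStem p ∨ T.IsCycle p) ∧ ∀ i, ∃ p ∈ P, Sum.inr i ∈ p

/-- `P` contains a stem and a cycle intersecting at some node. -/
def StemMeetsCycle (T : StructuredSystem ι κ) (P : Finset (List (κ ⊕ ι))) : Prop :=
  ∃ p ∈ P, ∃ q ∈ P, T.IsStem p ∧ T.IsCycle q ∧ ∃ w, w ∈ p ∧ w ∈ q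

/-- `P` contains two cycles intersecting at some node. -/
def CycleMeetsCycle (T : StructuredSystem ι κ) (P : Finset (List (κ ⊕ ι))) : Prop :=
  ∃ p ∈ P, ∃ q ∈ P, p ≠ q ∧ T.IsCycle p ∧ T.IsCycle q ∧ ∃ w, w ∈ p ∧ w ∈ q

/-- `P` contains two stems, intersecting at some node, that originate from different input nodes. -/
def StemMeetsStem (T : StructuredSystem ι κ) (P : Finset (List (κ ⊕ ι))) : Prop :=
  ∃ p ∈ P, ∃ q ∈ P, T.IsStem p ∧ T.IsStem q ∧ p.head? ≠ q.head? ∧ ∃ w, w ∈ p ∧ w ∈ q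

/-- `P` contains two different stems that originate from the same input node. -/
def StemsShareInput (T : StructuredSystem ι κ) (P : Finset (List (κ ⊕ ι))) : Prop :=
  ∃ p ∈ P, ∃ q ∈ P, p ≠ q ∧ T.IsStem p ∧ T.IsStem q ∧ p.head? = q.head?

/-- A set of stems and cycles covering the state nodes in which some paths intersect, but no two
stems originate from the same input node. -/
def IsXCover (T : StructuredSystem ι κ) (P : Finset (List (κ ⊕ ι))) : Prop :=
  T.IsCover P ∧ (T.StemMeetsCycle P ∨ T.CycleMeetsCycle P ∨ T.StemMeetsStem P) ∧
    ¬ T.StemsShareInput P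

open Classical in
/-- The number of paths of `P` through the state node `i`. -/
noncomputable def pathCount (P : Finset (List (κ ⊕ ι))) (i : ι) : ℕ :=
  (P.filter fun p => Sum.inr i ∈ p).card

end StructuredSystem

/-- A structured network of `n` first-order subsystems with trivial internal dynamics and `m`
inputs. -/
structure NetworkSystem (n m : ℕ) where
  /-- subsystem `j` influences subsystem `i`: the weight `a i j` is a free parameter -/
  link : Fin n → Fin n → Prop
  /-- the internal dynamics are trivial -/
  link_irrefl : ∀ i, ¬ link i i
  /-- the input component `s` enters subsystem `i`: the entry `b i s` is a free parameter -/
  input : Fin n → Fin m → Prop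

namespace NetworkSystem

variable {n m : ℕ}

/-- The network as a structured linear system. -/
def system (S : NetworkSystem n m) : StructuredSystem (Fin n) (Fin m) where
  freeA := S.link
  freeB := S.input

/-- X-networks: input-accessible, not structurally controllable, and covered by a set of stems and
cycles with intersections, but without two stems originating from the same input node. -/
def IsXNetwork (S : NetworkSystem n m) : Prop :=
  S.system.InputAccessible ∧ ¬ S.system.StructurallyControllable ∧ ∃ P, S.system.IsXCover P

/-- An extended system of the network `S`: subsystem `i` gets `ord i ≥ 1` states; each block of
interconnection weights or of input weights is either generic or zero, and generic only if the
corresponding entry of `S` is free; each block of internal dynamics is either generic or zero. -/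
structure Extension (S : NetworkSystem n m) where
  /-- the order of each subsystem -/
  ord : Fin n → ℕ
  ord_pos : ∀ i, 1 ≤ ord i
  /-- the subsystem has generic (heterogeneous) internal dynamics -/
  het : Fin n → Prop
  /-- the block of weights from subsystem `j` to subsystem `i` is generic -/
  link : Fin n → Fin n → Prop
  link_imp : ∀ i j, link i j → S.link i j
  /-- the block of weights from the input component `s` to subsystem `i` is generic -/
  input : Fin n → Fin m → Prop
  input_imp : ∀ i s, input i s → S.input i s

namespace Extension

variable {S : NetworkSystem n m}

/-- The states of the extended system: `⟨i, k⟩` is the `k`-th state of subsystem `i`. -/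
abbrev State (E : S.Extension) : Type := (i : Fin n) × Fin (E.ord i)

/-- The extended system as a structured linear system. -/
def system (E : S.Extension) : StructuredSystem E.State (Fin m) where
  freeA x y := (x.1 = y.1 ∧ E.het x.1) ∨ E.link x.1 y.1
  freeB x s := E.input x.1 s

/-- All subsystems have homogeneous (trivial) internal dynamics. -/
def IsHomogeneous (E : S.Extension) : Prop := ∀ i, ¬ E.het i

/-- The block diagonal output matrix with one output per subsystem, built from the rows `c i`. -/
def outputMatrix (E : S.Extension) (c : (i : Fin n) → Fin (E.ord i) → ℝ) :
    Matrix (Fin n) E.State ℝ :=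
  Matrix.of fun i x => if x.1 = i then c x.1 x.2 else 0

/-- Some numerical realization has an output controllability matrix of full row rank. The output
row of a subsystem of order greater than one is free, that of a first-order subsystem is `1`. -/
def StructurallyOutputControllable (E : S.Extension) : Prop :=
  ∃ (A : Matrix E.State E.State ℝ) (B : Matrix E.State (Fin m) ℝ)
    (c : (i : Fin n) → Fin (E.ord i) → ℝ),
    E.system.IsRealization A B ∧ (∀ i, E.ord i = 1 → ∀ k, c i k = 1) ∧
      (E.outputMatrix c * ctrbMatrix A B).rank = n

/-- The map from the nodes of the extended graph to the nodes of the original graph that forgets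
the index of a state inside its subsystem. -/
def proj (E : S.Extension) : Fin m ⊕ E.State → Fin m ⊕ Fin n := Sum.map id Sigma.fst

/-- `lift` turns the paths of `P` into vertex-disjoint stems and cycles of the extended graph, which
cover all its state nodes: stems are lifted to stems, cycles to cycles, node by node. -/
def IsDisjointLift (E : S.Extension) (P : Finset (List (Fin m ⊕ Fin n)))
    (lift : List (Fin m ⊕ Fin n) → List (Fin m ⊕ E.State)) : Prop :=
  (∀ p ∈ P, (lift p).map E.proj = p ∧
    (S.system.IsStem p → E.system.IsStem (lift p)) ∧
    (S.system.IsCycle p → E.system.IsCycle (lift p))) ∧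
  (∀ p ∈ P, ∀ q ∈ P, p ≠ q → (lift p).Disjoint (lift q)) ∧
  ∀ x : E.State, ∃ p ∈ P, Sum.inr x ∈ lift p

end Extension

end NetworkSystem

/-! The paths through state `i` are numbered by the states of subsystem `i` in the extension, and
each path uses its own copy of `i`. Lifts can then meet only at input nodes, which lie only at the
heads of stems, and no two stems of the cover share one. So the cover becomes vertex-disjoint
(`exists_isDisjointLift`). Accessibility also lifts, since every subsystem has a state and all links
are kept.

Controllability then follows from the sufficiency half of Lin's theorem. The disjoint paths give an
injective predecessor map `π` on states (`exists_injective_pred`). States fed by an input along `π`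
form chains, controllable with unit weights; the rest split into cycles. Cycles are attached one at
a time (`HasHautusRealization.union_cycle`), each through an edge supplied by accessibility, with a
common weight `t` on the cycle. A left eigenvector that does not vanish on the cycle has eigenvalue
of modulus `t`, while one that violates the Hautus test through the new edge can occur for only
finitely many eigenvalues; a large `t` excludes it.

Full row rank of the controllability matrix survives multiplication by an output matrix with
independent rows, which gives output controllability. -/

/-! ### Finiteness of the exceptional values of `μ` -/

/-- If no invariant subspace inside `N` contains `f`, then `T x = μ • x + f` has a solution `x ∈ N`
for only finitely many `μ`. -/
theorem Module.End.finite_setOf_exists_apply_eq_smul_add {K E : Type*} [Field K] [AddCommGroup E]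
    [Module K E] [FiniteDimensional K E] (T : Module.End K E) (N : Submodule K E) (f : E)
    (hf : ∀ V : Submodule K E, (∀ x ∈ V, T x ∈ V) → V ≤ N → f ∉ V) :
    {μ : K | ∃ x ∈ N, T x = μ • x + f}.Finite := by
  classical
  set S := {μ : K | ∃ x ∈ N, T x = μ • x + f}
  have hS : ∀ μ : S, ∃ x ∈ N, T x = (μ : K) • x + f := fun μ => μ.2
  choose x hxN hx using hS
  -- If the span of the chosen solutions contained `f`, it would be `T`-invariant, as `T x_μ = μ x_μ
  -- + f`.
  have hfV : f ∉ Submodule.span K (Set.range x) := by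
    intro hmem
    refine hf (Submodule.span K (Set.range x)) (fun y hy => ?_)
      (Submodule.span_le.2 (by rintro _ ⟨μ, rfl⟩; exact hxN μ)) hmem
    induction hy using Submodule.span_induction with
    | mem y hy =>
      obtain ⟨μ, rfl⟩ := hy
      rw [hx]
      exact add_mem (Submodule.smul_mem _ _ (Submodule.subset_span ⟨μ, rfl⟩)) hmem
    | zero => simp
    | add y z _ _ hy hz => rw [map_add]; exact add_mem hy hz
    | smul a y _ hy => rw [map_smul]; exact Submodule.smul_mem _ _ hy
  -- Applying `T` to a relation adds a multiple of `f`, which must vanish. Hence the coefficients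
  -- sum to zero, and multiplying each one by its own `μ` gives a relation again.
  have step : ∀ (s : Finset S) (g : S → K), ∑ i ∈ s, g i • x i = 0 →
      ∑ i ∈ s, g i = 0 ∧ ∑ i ∈ s, (g i * (i : K)) • x i = 0 := by
    intro s g hg
    have h1 : ∑ i ∈ s, (g i * (i : K)) • x i + (∑ i ∈ s, g i) • f = 0 := by
      have := congrArg T hg
      rw [map_sum, map_zero] at this
      rw [← this, Finset.sum_smul, ← Finset.sum_add_distrib]
      refine Finset.sum_congr rfl fun i _ => ?_
      rw [map_smul, hx, smul_add, smul_smul]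
    have h0 : ∑ i ∈ s, g i = 0 := by
      by_contra hne
      apply hfV
      have h2 : (∑ i ∈ s, g i) • f ∈ Submodule.span K (Set.range x) := by
        rw [eq_neg_of_add_eq_zero_right h1]
        exact neg_mem (sum_mem fun i _ =>
          Submodule.smul_mem _ _ (Submodule.subset_span ⟨i, rfl⟩))
      exact (Submodule.smul_mem_iff _ hne).1 h2
    refine ⟨h0, ?_⟩
    simpa [h0] using h1
  have hli : LinearIndependent K x := by
    rw [linearIndependent_iff']
    intro s g hg i hi
    -- By iteration, coefficients may be multiplied by a polynomial in `μ`. The one with roots at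
    -- all other indices of `s` leaves only the `i`-th coefficient in the sum.
    have key : ∀ r : Finset S, ∑ j ∈ s, (g j * ∏ k ∈ r, ((j : K) - (k : K))) • x j = 0 := by
      intro r
      induction r using Finset.induction_on with
      | empty => simpa using hg
      | insert a r ha ih =>
        have h2 := (step s _ ih).2
        have h3 := congrArg (fun y => (a : K) • y) ih
        simp only [Finset.smul_sum, smul_smul, smul_zero] at h3
        rw [← sub_zero (0 : E)]
        nth_rewrite 2 [← h3]
        rw [← h2, ← Finset.sum_sub_distrib]
        refine Finset.sum_congr rfl fun j _ => ?_
        rw [Finset.prod_insert ha, ← sub_smul]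
        congr 1
        ring
    have h4 := (step s _ (key (s.erase i))).1
    rw [Finset.sum_eq_single_of_mem i hi] at h4
    · refine (mul_eq_zero.1 h4).resolve_right (Finset.prod_ne_zero_iff.2 fun k hk => ?_)
      exact sub_ne_zero.2 fun h => (Finset.ne_of_mem_erase hk) (Subtype.ext h.symm)
    · intro j hj hne
      rw [Finset.prod_eq_zero (Finset.mem_erase.2 ⟨hne, hj⟩) (sub_self _), mul_zero]
  have := hli.finite
  exact Set.toFinite S

open Matrix

/-! ### The Hautus test and the controllability matrix -/

namespace StructuredSystem

variable {ι κ : Type}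

/-- The Hautus test for the left eigenvectors of `A` that are supported on `U`. -/
def HautusOn [Fintype ι] (A : Matrix ι ι ℝ) (B : Matrix ι κ ℝ) (U : Set ι) : Prop :=
  ∀ (μ : ℂ) (w : ι → ℂ), (∀ i, i ∉ U → w i = 0) → w ᵥ* A.map Complex.ofReal = μ • w →
    w ᵥ* B.map Complex.ofReal = 0 → w = 0

/-- A nonzero invariant subspace over `ℂ` contains an eigenvector, which the Hautus test forbids. -/
theorem HautusOn.eq_bot [Fintype ι] {A : Matrix ι ι ℝ} {B : Matrix ι κ ℝ} {U : Set ι}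
    (h : HautusOn A B U) (V : Submodule ℂ (ι → ℂ))
    (hV : ∀ w ∈ V, (∀ i, i ∉ U → w i = 0) ∧ w ᵥ* A.map Complex.ofReal ∈ V ∧
      w ᵥ* B.map Complex.ofReal = 0) : V = ⊥ := by
  by_contra hne
  have : Nontrivial V := Submodule.nontrivial_iff_ne_bot.2 hne
  let T : Module.End ℂ (ι → ℂ) := Matrix.vecMulLinear (A.map Complex.ofReal)
  have hT : ∀ w ∈ V, T w ∈ V := fun w hw => (hV w hw).2.1
  obtain ⟨μ, hμ⟩ := Module.End.exists_eigenvalue (LinearMap.restrict T hT)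
  obtain ⟨w, hw⟩ := hμ.exists_hasEigenvector
  apply hw.2
  apply Subtype.ext
  refine h μ w.1 (hV w w.2).1 ?_ (hV w w.2).2.2
  exact congrArg Subtype.val hw.apply_eq_smul

/-- By Cayley–Hamilton, a vector killed by the controllability matrix is killed by every `A ^ k *
B`. Over `ℂ`, such vectors form an invariant subspace inside the left kernel of `B`. -/
theorem HautusOn.vecMul_ctrbMatrix_injective [Fintype ι] [DecidableEq ι] {A : Matrix ι ι ℝ}
    {B : Matrix ι κ ℝ} (h : HautusOn A B Set.univ) :
    Function.Injective fun w : ι → ℝ => w ᵥ* ctrbMatrix A B := by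
  have hall : ∀ w : ι → ℝ, w ᵥ* ctrbMatrix A B = 0 → ∀ k : ℕ, w ᵥ* (A ^ k * B) = 0 := by
    intro w hw k
    have hlt : ∀ j < Fintype.card ι, w ᵥ* (A ^ j * B) = 0 := fun j hj =>
      funext fun s => congrFun hw (⟨j, hj⟩, s)
    -- Without states the characteristic polynomial is `1`, and the strict degree bound below fails.
    rcases isEmpty_or_nonempty ι with hι | hι
    · ext s; simp [vecMul, dotProduct]
    have hdeg : (Polynomial.X ^ k %ₘ A.charpoly).natDegree < Fintype.card ι := by
      have h1 := Polynomial.natDegree_modByMonic_lt (Polynomial.X ^ k) A.charpoly_monic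
        (fun h => by
          have := A.charpoly_natDegree_eq_dim
          rw [h, Polynomial.natDegree_one] at this
          exact Fintype.card_ne_zero this.symm)
      rwa [A.charpoly_natDegree_eq_dim] at h1
    rw [Matrix.pow_eq_aeval_mod_charpoly, Polynomial.aeval_eq_sum_range' hdeg, Matrix.sum_mul]
    have : w ᵥ* (∑ i ∈ Finset.range (Fintype.card ι),
        (Polynomial.X ^ k %ₘ A.charpoly).coeff i • A ^ i * B) =
        ∑ i ∈ Finset.range (Fintype.card ι),
          w ᵥ* ((Polynomial.X ^ k %ₘ A.charpoly).coeff i • A ^ i * B) := by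
      rw [Matrix.vecMul_sum]
    rw [this]
    refine Finset.sum_eq_zero fun i hi => ?_
    rw [Matrix.smul_mul, Matrix.vecMul_smul, hlt i (Finset.mem_range.1 hi), smul_zero]
  let V : Submodule ℂ (ι → ℂ) :=
    ⨅ k : ℕ, LinearMap.ker (Matrix.vecMulLinear ((A ^ k * B).map Complex.ofReal))
  have hmemV : ∀ w, w ∈ V ↔ ∀ k : ℕ, w ᵥ* ((A ^ k * B).map Complex.ofReal) = 0 := by
    intro w; simp [V]
  have hV : V = ⊥ := by
    refine h.eq_bot V fun w hw => ⟨fun i hi => absurd (Set.mem_univ i) hi, ?_, ?_⟩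
    · rw [hmemV] at hw ⊢
      intro k
      rw [Matrix.vecMul_vecMul, ← hw (k + 1), pow_succ', Matrix.mul_assoc]
      congr 1
      exact (Matrix.map_mul (f := Complex.ofRealHom)).symm
    · simpa using (hmemV w).1 hw 0
  rw [← Matrix.coe_vecMulLinear, injective_iff_map_eq_zero]
  intro w hw
  have hmem : (fun i => (w i : ℂ)) ∈ V := by
    rw [hmemV]
    intro k
    ext s
    have := congrFun (hall w hw k) s
    simp only [vecMul, dotProduct, Matrix.map_apply, Pi.zero_apply] at this ⊢
    exact_mod_cast this
  rw [hV, Submodule.mem_bot] at hmem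
  ext i
  exact Complex.ofReal_eq_zero.1 (congrFun hmem i)

end StructuredSystem

/-! ### Sufficiency in Lin's theorem -/

namespace StructuredSystem

variable {ι κ : Type}

/-- These `μ` are the only ones at which attaching a new state through the row `(a, b)` can break
the test. If `b = 0`, an invariant subspace of the admissible vectors is zero and so misses `a`; if
`a = 0` and `b ≠ 0`, then `μ` is an eigenvalue. -/
theorem HautusOn.finite_setOf_vecMul_eq [Fintype ι] {A : Matrix ι ι ℝ} {B : Matrix ι κ ℝ}
    {U : Set ι} (h : HautusOn A B U) (a : ι → ℂ) (b : κ → ℂ)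
    (hab : (b = 0 ∧ ∃ u ∈ U, a u ≠ 0) ∨ (a = 0 ∧ b ≠ 0)) :
    {μ : ℂ | ∃ x : ι → ℂ, (∀ i, i ∉ U → x i = 0) ∧
      x ᵥ* A.map Complex.ofReal = μ • x + a ∧ x ᵥ* B.map Complex.ofReal = b}.Finite := by
  let T : Module.End ℂ (ι → ℂ) := Matrix.vecMulLinear (A.map Complex.ofReal)
  rcases hab with ⟨rfl, u, hu, hau⟩ | ⟨rfl, hb⟩
  · let N : Submodule ℂ (ι → ℂ) :=
      (⨅ i : {i // i ∉ U}, LinearMap.ker (LinearMap.proj (R := ℂ) (φ := fun _ : ι => ℂ) i.1)) ⊓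
        LinearMap.ker (Matrix.vecMulLinear (B.map Complex.ofReal))
    have hN : ∀ x, x ∈ N ↔ (∀ i, i ∉ U → x i = 0) ∧ x ᵥ* B.map Complex.ofReal = 0 := by
      intro x; simp [N]
    refine (T.finite_setOf_exists_apply_eq_smul_add N a fun V hV hVN ha => ?_).subset ?_
    · have hbot := h.eq_bot V fun w hw =>
        ⟨((hN w).1 (hVN hw)).1, hV w hw, ((hN w).1 (hVN hw)).2⟩
      rw [hbot, Submodule.mem_bot] at ha
      exact hau (congrFun ha u)
    · rintro μ ⟨x, hxU, hxA, hxB⟩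
      exact ⟨x, (hN x).2 ⟨hxU, hxB⟩, hxA⟩
  · refine T.finite_hasEigenvalue.subset ?_
    rintro μ ⟨x, -, hxA, hxB⟩
    refine Module.End.hasEigenvalue_of_hasEigenvector (x := x)
      ⟨Module.End.mem_eigenspace_iff.2 (hxA.trans (add_zero _)), ?_⟩
    rintro rfl
    exact hb (by rw [← hxB, zero_vecMul])

/-- Some realization that involves only the states of `U` passes the Hautus test on `U`. -/
def HasHautusRealization [Fintype ι] (T : StructuredSystem ι κ) (U : Set ι) : Prop :=
  ∃ (A : Matrix ι ι ℝ) (B : Matrix ι κ ℝ), T.IsRealization A B ∧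
    (∀ i j, A i j ≠ 0 → i ∈ U ∧ j ∈ U) ∧ (∀ i s, B i s ≠ 0 → i ∈ U) ∧ HautusOn A B U

/-- The states reached from an input by following the predecessor map `π`. -/
inductive IsFedBy (π : ι → κ ⊕ ι) : ι → Prop
  | input {i : ι} {s : κ} (h : π i = Sum.inl s) : IsFedBy π i
  | state {i j : ι} (h : π i = Sum.inr j) (hj : IsFedBy π j) : IsFedBy π i

/-- With unit weights along `π`, an eigenvector killed by `B` vanishes at states fed directly by an
input. Column `j` then reads `w i = μ * w j` for the successor `i` of `j`, so zeros propagate,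
whatever `μ` is. -/
theorem hasHautusRealization_isFedBy [Fintype ι] (T : StructuredSystem ι κ) (π : ι → κ ⊕ ι)
    (hπ : Function.Injective π) (hadj : ∀ i, T.graph.Adj (π i) (Sum.inr i)) :
    T.HasHautusRealization {i | IsFedBy π i} := by
  classical
  let A : Matrix ι ι ℝ := Matrix.of fun i j => if IsFedBy π j ∧ π i = Sum.inr j then 1 else 0
  let B : Matrix ι κ ℝ := Matrix.of fun i s => if π i = Sum.inl s then 1 else 0
  refine ⟨A, B, ⟨fun i j hij => if_neg fun h => hij ?_, fun i s his => if_neg fun h => his ?_⟩,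
    fun i j hij => ?_, fun i s his => ?_, ?_⟩
  · have := hadj i
    rwa [h.2] at this
  · have := hadj i
    rwa [h] at this
  · have h : IsFedBy π j ∧ π i = Sum.inr j := by
      by_contra h
      exact hij (if_neg h)
    exact ⟨.state h.2 h.1, h.1⟩
  · have h : π i = Sum.inl s := by
      by_contra h
      exact his (if_neg h)
    exact .input h
  · intro μ w hw hA hB
    ext i
    by_cases hi : IsFedBy π i
    swap
    · exact hw i hi
    induction hi with
    | @input i s h =>
      have h1 := congrFun hB s
      rw [vecMul, dotProduct, Finset.sum_eq_single i] at h1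
      · simpa [B, h] using h1
      · intro j _ hj
        have : π j ≠ Sum.inl s := fun h' => hj (hπ (h'.trans h.symm))
        simp [B, this]
      · simp
    | @state i j h hj ih =>
      have h1 := congrFun hA j
      rw [vecMul, dotProduct, Finset.sum_eq_single i] at h1
      · simp only [Pi.smul_apply, ih] at h1
        simpa [A, h, hj] using h1
      · intro k _ hk
        have : π k ≠ Sum.inr j := fun h' => hk (hπ (h'.trans h.symm))
        simp [A, this]
      · simp

/-- A cycle `V` of the predecessor map with an edge from an input or from a state of `U` to one of
its states can be added to `U`. -/
theorem HasHautusRealization.union_cycle [Fintype ι] {T : StructuredSystem ι κ} {U V : Set ι}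
    (h : T.HasHautusRealization U) (hUV : Disjoint U V) (f : ι → ι) (hfV : Set.BijOn f V V)
    (hadj : ∀ i ∈ V, T.freeA i (f i)) (v : ι) (hv : v ∈ V)
    (hgen : ∀ i ∈ V, Relation.ReflTransGen (fun i j => f i = j) v i)
    (z : κ ⊕ ι) (hz : ∀ u, z = Sum.inr u → u ∈ U) (hzv : T.graph.Adj z (Sum.inr v)) :
    T.HasHautusRealization (U ∪ V) := by
  classical
  obtain ⟨A, B, hreal, hA, hB, hH⟩ := h
  -- The row `(a, b)` is the indicator of the source `z` of the attaching edge, which gets weight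
  -- `1`.
  let a : ι → ℂ := fun j => if z = Sum.inr j then 1 else 0
  let b : κ → ℂ := fun s => if z = Sum.inl s then 1 else 0
  have hab : (b = 0 ∧ ∃ u ∈ U, a u ≠ 0) ∨ (a = 0 ∧ b ≠ 0) := by
    rcases z with s | u
    · exact Or.inr ⟨by ext; simp [a], fun h => by simpa [b] using congrFun h s⟩
    · exact Or.inl ⟨by ext; simp [b], u, hz u rfl, by simp [a]⟩
  -- `C` bounds the moduli of the exceptional eigenvalues; the cycle weight `t` is chosen beyond it.
  obtain ⟨C, hC⟩ := (((hH.finite_setOf_vecMul_eq a b hab).image (fun μ => ‖μ‖)).bddAbove)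
  obtain ⟨t, ht⟩ : ∃ t : ℝ, max C 0 < t := exists_gt _
  have hCt : C < t := (le_max_left _ _).trans_lt ht
  have ht0 : 0 < t := (le_max_right _ _).trans_lt ht
  have hVU : ∀ i ∈ V, i ∉ U := fun i hi hi' => Set.disjoint_left.1 hUV hi' hi
  let P : Matrix ι ι ℝ := Matrix.of fun i j => if i ∈ V ∧ f i = j then t else 0
  let E : Matrix ι ι ℝ := Matrix.of fun i j => if i = v ∧ z = Sum.inr j then 1 else 0
  let F : Matrix ι κ ℝ := Matrix.of fun i s => if i = v ∧ z = Sum.inl s then 1 else 0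
  have hP : ∀ i j, ¬ (i ∈ V ∧ f i = j) → P i j = 0 := fun i j h => if_neg h
  have hE : ∀ i j, ¬ (i = v ∧ z = Sum.inr j) → E i j = 0 := fun i j h => if_neg h
  have hF : ∀ i j, ¬ (i = v ∧ z = Sum.inl j) → F i j = 0 := fun i j h => if_neg h
  refine ⟨A + P + E, B + F, ⟨fun i j hij => ?_, fun i s his => ?_⟩, fun i j hij => ?_,
    fun i s his => ?_, ?_⟩
  · rw [Matrix.add_apply, Matrix.add_apply, hreal.1 i j hij, hP, hE]
    · simp
    · rintro ⟨rfl, rfl⟩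
      exact hij hzv
    · rintro ⟨hi, rfl⟩
      exact hij (hadj i hi)
  · rw [Matrix.add_apply, hreal.2 i s his, hF, add_zero]
    rintro ⟨rfl, rfl⟩
    exact his hzv
  · by_contra hcon
    apply hij
    have h1 : A i j = 0 := by
      by_contra h1
      exact hcon ⟨Or.inl (hA i j h1).1, Or.inl (hA i j h1).2⟩
    rw [Matrix.add_apply, Matrix.add_apply, h1, hP, hE]
    · simp
    · rintro ⟨rfl, h⟩
      exact hcon ⟨Or.inr hv, Or.inl (hz j h)⟩
    · rintro ⟨hi, rfl⟩
      exact hcon ⟨Or.inr hi, Or.inr (hfV.mapsTo hi)⟩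
  · by_contra hcon
    apply his
    have h1 : B i s = 0 := by
      by_contra h1
      exact hcon (Or.inl (hB i s h1))
    rw [Matrix.add_apply, h1, hF, add_zero]
    rintro ⟨rfl, h⟩
    exact hcon (Or.inr hv)
  intro μ w hw hwA hwB
  -- The part of `w` on `U` satisfies the eigenvector equations of `(A, B)` up to the perturbation
  -- `w v • (a, b)`.
  let x : ι → ℂ := fun i => if i ∈ U then w i else 0
  have hxU : ∀ i, i ∉ U → x i = 0 := fun i hi => if_neg hi
  have hcol : ∀ j, ∑ i, w i * (A i j : ℂ) + ∑ i, w i * (P i j : ℂ) + w v * a j = μ * w j := by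
    intro j
    have h1 := congrFun hwA j
    have h2 : ∑ i, w i * (E i j : ℂ) = w v * a j := by
      rw [Finset.sum_eq_single v]
      · by_cases h : z = Sum.inr j <;> simp [E, a, h]
      · intro i _ hi
        rw [hE i j fun h => hi h.1, Complex.ofReal_zero, mul_zero]
      · simp
    rw [← h2, ← Finset.sum_add_distrib, ← Finset.sum_add_distrib]
    refine Eq.trans (Finset.sum_congr rfl fun i _ => ?_) h1
    simp only [map_apply, Matrix.add_apply]
    push_cast
    ring
  have hxA' : ∀ j, (x ᵥ* A.map Complex.ofReal) j = ∑ i, w i * (A i j : ℂ) := by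
    refine fun j => Finset.sum_congr rfl fun i _ => ?_
    by_cases hi : i ∈ U
    · simp [x, hi]
    · have : A i j = 0 := by
        by_contra h1
        exact hi (hA i j h1).1
      simp [this]
  have hxA : x ᵥ* A.map Complex.ofReal = μ • x - w v • a := by
    ext j
    rw [hxA' j]
    by_cases hj : j ∈ U
    · have h1 := hcol j
      rw [Finset.sum_eq_zero (f := fun i => w i * (P i j : ℂ))] at h1
      · simp only [x, Pi.sub_apply, Pi.smul_apply, smul_eq_mul, hj, if_true]
        linear_combination h1
      · intro i _
        rw [hP i j fun h => hVU j (h.2 ▸ hfV.mapsTo h.1) hj, Complex.ofReal_zero, mul_zero]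
    · have h1 : a j = 0 := if_neg fun h => hj (hz j h)
      simp only [Pi.sub_apply, Pi.smul_apply, hxU j hj, h1, smul_zero, sub_zero]
      refine Finset.sum_eq_zero fun i _ => ?_
      have : A i j = 0 := by
        by_contra h1
        exact hj (hA i j h1).2
      simp [this]
  have hxB : x ᵥ* B.map Complex.ofReal = -(w v • b) := by
    ext s
    have h1 := congrFun hwB s
    have h2 : ∑ i, w i * (F i s : ℂ) = w v * b s := by
      rw [Finset.sum_eq_single v]
      · by_cases h : z = Sum.inl s <;> simp [F, b, h]
      · intro i _ hi
        rw [hF i s fun h => hi h.1, Complex.ofReal_zero, mul_zero]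
      · simp
    have h3 : (x ᵥ* B.map Complex.ofReal) s = ∑ i, w i * (B i s : ℂ) := by
      refine Finset.sum_congr rfl fun i _ => ?_
      by_cases hi : i ∈ U
      · simp [x, hi]
      · have : B i s = 0 := by
          by_contra h1
          exact hi (hB i s h1)
        simp [this]
    have h4 : ∑ i, w i * (B i s : ℂ) + ∑ i, w i * (F i s : ℂ) = 0 := by
      rw [← Finset.sum_add_distrib]
      refine Eq.trans (Finset.sum_congr rfl fun i _ => ?_) h1
      simp only [map_apply, Matrix.add_apply]
      push_cast
      ring
    rw [h3, Pi.neg_apply, Pi.smul_apply, smul_eq_mul, ← h2]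
    exact eq_neg_of_add_eq_zero_left h4
  have hcyc : ∀ i ∈ V, (t : ℂ) * w i = μ * w (f i) := by
    intro i hi
    have hfi := hfV.mapsTo hi
    rw [← hcol (f i), show a (f i) = 0 from if_neg fun h => hVU _ hfi (hz _ h),
      Finset.sum_eq_zero (f := fun k => w k * (A k (f i) : ℂ)), Finset.sum_eq_single i]
    · simp [P, hi, mul_comm]
    · intro k _ hk
      rw [hP k _ fun h => hk (hfV.injOn h.1 hi h.2), Complex.ofReal_zero, mul_zero]
    · simp
    · intro k _
      have : A k (f i) = 0 := by
        by_contra h1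
        exact hVU _ hfi (hA _ _ h1).2
      simp [this]
  -- Sum the norms in `hcyc` over `V`: since `f` permutes `V`, both sides carry the same sum.
  have hmod : (∀ i ∈ V, w i = 0) ∨ ‖μ‖ = t := by
    by_contra! hcon
    obtain ⟨⟨i, hi, hwi⟩, hne⟩ := hcon
    have h1 : ∑ i ∈ V.toFinset, ‖w (f i)‖ = ∑ i ∈ V.toFinset, ‖w i‖ := by
      refine Finset.sum_nbij f ?_ ?_ ?_ fun _ _ => rfl
      · intro i hi; simpa using hfV.mapsTo (by simpa using hi)
      · simpa using hfV.injOn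
      · simpa using hfV.surjOn
    have h2 : t * ∑ i ∈ V.toFinset, ‖w i‖ = ‖μ‖ * ∑ i ∈ V.toFinset, ‖w i‖ := by
      rw [Finset.mul_sum, ← h1, Finset.mul_sum]
      refine Finset.sum_congr rfl fun i hi => ?_
      have := congrArg norm (hcyc i (by simpa using hi))
      simpa [abs_of_pos ht0] using this
    have h3 : 0 < ∑ i ∈ V.toFinset, ‖w i‖ :=
      Finset.sum_pos' (fun _ _ => norm_nonneg _) ⟨i, by simpa using hi, norm_pos_iff.2 hwi⟩
    exact hne (mul_right_cancel₀ h3.ne' h2).symm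
  -- If `w v = 0`, the perturbation disappears and zeros spread around the cycle. Otherwise `-x / w
  -- v` makes `μ` exceptional, so `‖μ‖ ≤ C < t`, contradicting `‖μ‖ = t`.
  by_cases hwv : w v = 0
  · have hx0 : x = 0 := hH μ x hxU (by simpa [hwv] using hxA) (by simpa [hwv] using hxB)
    have hV0 : ∀ i ∈ V, w i = 0 := by
      rcases hmod with h | h
      · exact h
      have hμ : μ ≠ 0 := by
        rintro rfl
        rw [norm_zero] at h
        exact ht0.ne h
      intro i hi
      have hreach := hgen i hi
      suffices i ∈ V ∧ w i = 0 from this.2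
      clear hi
      induction hreach with
      | refl => exact ⟨hv, hwv⟩
      | @tail j k _ hjk ih =>
        subst hjk
        have := hcyc j ih.1
        rw [ih.2, mul_zero] at this
        exact ⟨hfV.mapsTo ih.1, (mul_eq_zero.1 this.symm).resolve_left hμ⟩
    ext i
    by_cases hiU : i ∈ U
    · have := congrFun hx0 i
      simpa [x, hiU] using this
    by_cases hiV : i ∈ V
    · exact hV0 i hiV
    · exact hw i fun h => h.elim hiU hiV
  · exfalso
    have hμt : ‖μ‖ = t := hmod.resolve_left fun h => hwv (h v hv)
    have : ‖μ‖ ≤ C := hC ⟨μ, ⟨(-(w v)⁻¹) • x, fun i hi => by simp [hxU i hi], ?_, ?_⟩, rfl⟩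
    · linarith
    · rw [smul_vecMul, hxA]
      ext j
      simp only [Pi.smul_apply, Pi.sub_apply, Pi.add_apply, smul_eq_mul]
      field_simp
      ring
    · rw [smul_vecMul, hxB]
      ext s
      simp only [Pi.smul_apply, Pi.neg_apply, smul_eq_mul]
      field_simp

/-- Sufficiency in Lin's theorem: if all states are accessible from the inputs, and each state can
be matched injectively with a predecessor, then some realization is controllable. -/
theorem exists_vecMul_ctrbMatrix_injective [Fintype ι] [DecidableEq ι] (T : StructuredSystem ι κ)
    (π : ι → κ ⊕ ι) (hπ : Function.Injective π) (hadj : ∀ i, T.graph.Adj (π i) (Sum.inr i))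
    (hacc : ∀ R : Set (κ ⊕ ι), (∀ s, Sum.inl s ∈ R) →
      (∀ a b, T.graph.Adj a b → a ∈ R → b ∈ R) → R = Set.univ) :
    ∃ (A : Matrix ι ι ℝ) (B : Matrix ι κ ℝ), T.IsRealization A B ∧
      Function.Injective fun w : ι → ℝ => w ᵥ* ctrbMatrix A B := by
  classical
  -- Saturation under `π` ensures that the complement of `U` is a union of whole cycles.
  let Closed : Set ι → Prop := fun U =>
    {i | IsFedBy π i} ⊆ U ∧ ∀ i j, π i = Sum.inr j → (i ∈ U ↔ j ∈ U)
  suffices ∀ (k : ℕ) (U : Set ι), Closed U → T.HasHautusRealization U → Uᶜ.ncard = k →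
      T.HasHautusRealization Set.univ by
    have hcl : Closed {i | IsFedBy π i} := by
      refine ⟨subset_rfl, fun i j hij => ⟨fun hi => ?_, fun hj => .state hij hj⟩⟩
      cases hi with
      | input h => simp [h] at hij
      | state h hj =>
        rw [h] at hij
        cases hij
        exact hj
    obtain ⟨A, B, hreal, -, -, hH⟩ := this _ _ hcl (T.hasHautusRealization_isFedBy π hπ hadj) rfl
    exact ⟨A, B, hreal, hH.vecMul_ctrbMatrix_injective⟩
  intro k
  induction k using Nat.strong_induction_on with
  | _ k ih =>
  rintro U ⟨hU, hcl⟩ hreal rfl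
  by_cases hne : U = Set.univ
  · rwa [← hne]
  obtain ⟨z, v, hzv, hz, hvU⟩ : ∃ (z : κ ⊕ ι) (v : ι), T.graph.Adj z (Sum.inr v) ∧
      (∀ u, z = Sum.inr u → u ∈ U) ∧ v ∉ U := by
    by_contra! hcon
    apply hne
    have h1 := hacc {x | ∀ u, x = Sum.inr u → u ∈ U} (by simp) fun a b hab ha u hu => by
      subst hu
      exact hcon a u hab ha
    ext i
    have : Sum.inr i ∈ {x : κ ⊕ ι | ∀ u, x = Sum.inr u → u ∈ U} := h1 ▸ Set.mem_univ _
    simpa using this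
  have hstate : ∀ i, i ∉ U → ∃ j, π i = Sum.inr j := by
    intro i hi
    rcases h : π i with s | j
    · exact absurd (hU (.input h)) hi
    · exact ⟨j, rfl⟩
  let f : ι → ι := fun i => Sum.elim (fun _ => i) id (π i)
  have hf : ∀ i, i ∉ U → π i = Sum.inr (f i) := by
    intro i hi
    obtain ⟨j, hj⟩ := hstate i hi
    simp [f, hj]
  let V : Set ι := {i | Relation.ReflTransGen (fun i j => f i = j) v i}
  have hVU : ∀ i ∈ V, i ∉ U := by
    intro i hi
    induction hi with
    | refl => exact hvU
    | @tail j k _ hjk ih =>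
      subst hjk
      exact fun h => ih ((hcl j _ (hf j ih)).2 h)
  have hmaps : Set.MapsTo f V V := fun i hi => hi.tail rfl
  have hinj : Set.InjOn f V := by
    intro i hi j hj hij
    apply hπ
    rw [hf i (hVU i hi), hf j (hVU j hj), hij]
  -- An injective self-map of a finite set is bijective, so the forward orbit of `v` is a cycle.
  have hbij : Set.BijOn f V V := ((Set.toFinite V).injOn_iff_bijOn_of_mapsTo hmaps).1 hinj
  have hv : v ∈ V := .refl
  refine ih _ ?_ (U ∪ V) ⟨hU.trans Set.subset_union_left, fun i j hij => ?_⟩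
    (hreal.union_cycle (Set.disjoint_right.2 hVU) f hbij (fun i hi => ?_) v hv (fun i hi => hi)
      z hz hzv) rfl
  · refine Set.ncard_lt_ncard ?_ (Set.toFinite _)
    exact compl_lt_compl_iff_lt.2
      ⟨Set.subset_union_left, fun h => hvU (h (Or.inr hv))⟩
  · constructor
    · rintro (hi | hi)
      · exact Or.inl ((hcl i j hij).1 hi)
      · have h1 := hf i (hVU i hi)
        rw [hij] at h1
        cases h1
        exact Or.inr (hmaps hi)
    · rintro (hj | hj)
      · exact Or.inl ((hcl i j hij).2 hj)
      · obtain ⟨k, hk, rfl⟩ := hbij.surjOn hj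
        have h1 := hf k (hVU k hk)
        rw [← hij] at h1
        exact Or.inr (hπ h1 ▸ hk)
  · have := hadj i
    rwa [hf i (hVU i hi)] at this

end StructuredSystem

/-! ### Stems, cycles and predecessors -/

namespace StructuredSystem

variable {ι κ : Type} {T : StructuredSystem ι κ}

theorem not_adj_inl (a : κ ⊕ ι) (s : κ) : ¬ T.graph.Adj a (Sum.inl s) := by
  rcases a with _ | _ <;> exact id

theorem not_adj_inl_of_isChain_cons {a : κ ⊕ ι} {l : List (κ ⊕ ι)}
    (h : (a :: l).IsChain T.graph.Adj) (s : κ) : Sum.inl s ∉ l := by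
  induction l generalizing a with
  | nil => simp
  | cons b l ih =>
    rw [List.isChain_cons_cons] at h
    rw [List.mem_cons, not_or]
    exact ⟨fun hb => not_adj_inl a s (hb ▸ h.1), ih h.2⟩

theorem IsStem.head?_eq {p : List (κ ⊕ ι)} (h : T.IsStem p) {s : κ} (hs : Sum.inl s ∈ p) :
    p.head? = some (Sum.inl s) := by
  obtain ⟨-, hc, -, -⟩ := h
  rcases p with _ | ⟨a, l⟩
  · simp at hs
  · rcases List.mem_cons.1 hs with rfl | hs
    · rfl
    · exact absurd hs (not_adj_inl_of_isChain_cons hc s)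

theorem IsCycle.mem_tail {p : List (κ ⊕ ι)} (h : T.IsCycle p) : ∀ x ∈ p, x ∈ p.tail := by
  obtain ⟨hl, -, -, hhl⟩ := h
  rcases p with _ | ⟨a, _ | ⟨b, l⟩⟩
  · simp at hl
  · simp at hl
  · intro x hx
    rcases List.mem_cons.1 hx with rfl | hx
    · rw [List.head?_cons, List.getLast?_cons_cons] at hhl
      exact List.mem_of_getLast? hhl.symm
    · exact hx

theorem IsCycle.inl_notMem {p : List (κ ⊕ ι)} (h : T.IsCycle p) (s : κ) : Sum.inl s ∉ p := by
  intro hs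
  have h1 := h.mem_tail _ hs
  obtain ⟨-, -, hc, -⟩ := h
  rcases p with _ | ⟨a, l⟩
  · simp at hs
  · exact not_adj_inl_of_isChain_cons hc s h1

/-- Every state on a path thus has a predecessor on it: a stem starts at an input, and a cycle
repeats its first node at the end. -/
theorem inr_mem_tail {p : List (κ ⊕ ι)} (h : T.IsStem p ∨ T.IsCycle p) {i : ι}
    (hi : Sum.inr i ∈ p) : Sum.inr i ∈ p.tail := by
  rcases h with ⟨-, -, ⟨s, hs⟩, -⟩ | h
  · rcases p with _ | ⟨a, l⟩
    · simp at hi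
    · simp only [List.head?_cons, Option.some.injEq] at hs
      subst hs
      simpa using hi
  · exact h.mem_tail _ hi

theorem nodup_dropLast {p : List (κ ⊕ ι)} (h : T.IsStem p ∨ T.IsCycle p) : p.dropLast.Nodup := by
  rcases h with h | ⟨-, hn, -, hhl⟩
  · exact h.1.sublist (List.dropLast_sublist p)
  · rcases List.eq_nil_or_concat p with rfl | ⟨l, b, rfl⟩
    · simp
    · rcases l with _ | ⟨a, l⟩
      · simp
      · rw [List.concat_eq_append] at *
        simp only [List.cons_append, List.head?_cons, List.tail_cons] at hhl hn
        rw [← List.cons_append, List.getLast?_concat, Option.some.injEq] at hhl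
        subst hhl
        rw [List.dropLast_concat]
        exact (List.perm_append_singleton a l).nodup_iff.1 hn

theorem isChain_adj {p : List (κ ⊕ ι)} (h : T.IsStem p ∨ T.IsCycle p) :
    p.IsChain T.graph.Adj := h.elim (fun h => h.2.1) fun h => h.2.2.1

/-- Vertex-disjoint stems and cycles that cover the states match the states injectively with
predecessors. -/
theorem exists_injective_pred (Q : Set (List (κ ⊕ ι))) (hQ : ∀ p ∈ Q, T.IsStem p ∨ T.IsCycle p)
    (hdisj : ∀ p ∈ Q, ∀ q ∈ Q, p ≠ q → p.Disjoint q) (hcov : ∀ i, ∃ p ∈ Q, Sum.inr i ∈ p) :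
    ∃ π : ι → κ ⊕ ι, Function.Injective π ∧ ∀ i, T.graph.Adj (π i) (Sum.inr i) := by
  have hpred : ∀ i : ι, ∃ p ∈ Q, ∃ (k : ℕ) (hk : k + 1 < p.length), p[k + 1] = Sum.inr i := by
    intro i
    obtain ⟨p, hp, hi⟩ := hcov i
    obtain ⟨k, hk, hki⟩ := List.getElem_of_mem (inr_mem_tail (hQ p hp) hi)
    rw [List.length_tail] at hk
    exact ⟨p, hp, k, by omega, by rw [← hki, List.getElem_tail]⟩
  choose p hp k hk hki using hpred
  have hk' : ∀ i, k i < (p i).length := fun i => (Nat.lt_succ_self _).trans (hk i)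
  refine ⟨fun i => (p i)[k i]'(hk' i), fun i j hij => ?_, fun i => ?_⟩
  · dsimp only at hij
    have hpp : p i = p j := by
      by_contra hne
      exact hdisj _ (hp i) _ (hp j) hne (List.getElem_mem (hk' i))
        (hij.symm ▸ List.getElem_mem (hk' j))
    -- On a single path, positions of predecessors lie in `dropLast`, which has no repetition even
    -- for a cycle, so equal predecessors have equal positions. The variable `q` avoids rewriting
    -- inside dependent indices.
    have hget : ∀ q (hq : k j + 1 < q.length), p i = q → (p i)[k i]'(hk' i) = q[k j] →
        q[k j + 1] = Sum.inr j → i = j := by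
      rintro q hq rfl h1 h2
      have h3 : k i = k j := by
        have hi : k i < (p i).dropLast.length := by
          have := hk i
          rw [List.length_dropLast]
          omega
        have hj : k j < (p i).dropLast.length := by
          rw [List.length_dropLast]
          omega
        refine (nodup_dropLast (hQ _ (hp i))).getElem_inj_iff (hi := hi) (hj := hj) |>.1 ?_
        rw [List.getElem_dropLast, List.getElem_dropLast]
        exact h1
      have h4 := hki i
      simp only [h3] at h4
      exact Sum.inr.inj (h4.symm.trans h2)
    exact hget _ (hk j) hpp hij (hki j)
  · have := List.isChain_iff_getElem.1 (isChain_adj (hQ _ (hp i))) (k i) (hk i)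
    rwa [hki i] at this

theorem InputAccessible.eq_univ (h : T.InputAccessible) {R : Set (κ ⊕ ι)}
    (hR : ∀ s, Sum.inl s ∈ R) (hcl : ∀ a b, T.graph.Adj a b → a ∈ R → b ∈ R) : R = Set.univ := by
  ext x
  rcases x with s | i
  · simp [hR]
  · obtain ⟨p, ⟨-, hc, ⟨s, hs⟩, -⟩, hi⟩ := h i
    simp only [Set.mem_univ, iff_true]
    refine List.IsChain.induction (· ∈ R) p hc hcl (fun hne => ?_) _ (List.mem_of_getLast? hi)
    rw [List.head?_eq_some_head hne, Option.some.injEq] at hs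
    rw [hs]
    exact hR s

theorem IsStem.map {ι' : Type} {T' : StructuredSystem ι' κ} {φ : κ ⊕ ι → κ ⊕ ι'}
    (hφ : Function.Injective φ) (hadj : ∀ a b, T.graph.Adj a b → T'.graph.Adj (φ a) (φ b))
    (hl : ∀ s, φ (Sum.inl s) = Sum.inl s) (hr : ∀ i, ∃ j, φ (Sum.inr i) = Sum.inr j)
    {p : List (κ ⊕ ι)} (h : T.IsStem p) : T'.IsStem (p.map φ) := by
  obtain ⟨hn, hc, ⟨s, hs⟩, ⟨i, hi⟩⟩ := h
  obtain ⟨j, hj⟩ := hr i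
  exact ⟨hn.map hφ, (List.isChain_map φ).2 (hc.imp hadj), ⟨s, by simp [hs, hl]⟩,
    ⟨j, by simp [hi, hj]⟩⟩

theorem IsCycle.map {ι' : Type} {T' : StructuredSystem ι' κ} {φ : κ ⊕ ι → κ ⊕ ι'}
    (hφ : Function.Injective φ) (hadj : ∀ a b, T.graph.Adj a b → T'.graph.Adj (φ a) (φ b))
    {p : List (κ ⊕ ι)} (h : T.IsCycle p) : T'.IsCycle (p.map φ) := by
  obtain ⟨hl, hn, hc, hhl⟩ := h
  exact ⟨by simpa using hl, by rw [← List.map_tail]; exact hn.map hφ,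
    (List.isChain_map φ).2 (hc.imp hadj), by simp [hhl]⟩

end StructuredSystem

/-! ### The homogeneous extension and the disjoint lift -/

namespace NetworkSystem

variable {n m : ℕ} {S : NetworkSystem n m}

open StructuredSystem

/-- The homogeneous extended system with the given orders that keeps all interconnections. -/
def homogeneousExtension (S : NetworkSystem n m) (ord : Fin n → ℕ) (h : ∀ i, 1 ≤ ord i) :
    S.Extension where
  ord := ord
  ord_pos := h
  het _ := False
  link := S.link
  link_imp _ _ := id
  input := S.input
  input_imp _ _ := id

theorem homogeneousExtension_adj {ord : Fin n → ℕ} {h : ∀ i, 1 ≤ ord i}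
    (a b : Fin m ⊕ (S.homogeneousExtension ord h).State) :
    (S.homogeneousExtension ord h).system.graph.Adj a b ↔
      S.system.graph.Adj ((S.homogeneousExtension ord h).proj a)
        ((S.homogeneousExtension ord h).proj b) := by
  rcases a with _ | _ <;> rcases b with _ | _
  · exact Iff.rfl
  · exact Iff.rfl
  · exact Iff.rfl
  · exact ⟨fun h => h.elim (fun h => h.2.elim) id, Or.inr⟩

/-- Accessibility of `S` is applied to the nodes whose whole fibre lies in `R`. They are closed
under edges because adjacency depends only on projections and every fibre is nonempty. -/
theorem homogeneousExtension_closed_eq_univ (hS : S.system.InputAccessible) {ord : Fin n → ℕ}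
    {h : ∀ i, 1 ≤ ord i} (R : Set (Fin m ⊕ (S.homogeneousExtension ord h).State))
    (hR : ∀ s, Sum.inl s ∈ R)
    (hcl : ∀ a b, (S.homogeneousExtension ord h).system.graph.Adj a b → a ∈ R → b ∈ R) :
    R = Set.univ := by
  have h1 := hS.eq_univ (R := {z | ∀ z', (S.homogeneousExtension ord h).proj z' = z → z' ∈ R})
    (fun s z' hz' => ?_) fun a b hab ha z' hz' => ?_
  · ext z
    have : (S.homogeneousExtension ord h).proj z ∈
      {z | ∀ z', (S.homogeneousExtension ord h).proj z' = z → z' ∈ R} := h1 ▸ Set.mem_univ _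
    simpa using this z rfl
  · rcases z' with s' | x
    · exact hR s'
    · simp [Extension.proj] at hz'
  · obtain ⟨a', rfl⟩ : ∃ a', (S.homogeneousExtension ord h).proj a' = a := by
      rcases a with s | i
      · exact ⟨Sum.inl s, rfl⟩
      · exact ⟨Sum.inr ⟨i, ⟨0, h i⟩⟩, rfl⟩
    subst hz'
    exact hcl a' z' ((homogeneousExtension_adj _ _).2 hab) (ha a' rfl)

theorem _root_.StructuredSystem.IsCover.one_le_pathCount {ι κ : Type} {T : StructuredSystem ι κ}
    {P : Finset (List (κ ⊕ ι))} (h : T.IsCover P) (i : ι) : 1 ≤ pathCount P i := by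
  classical
  obtain ⟨p, hp, hi⟩ := h.2 i
  exact Finset.card_pos.2 ⟨p, Finset.mem_filter.2 ⟨hp, hi⟩⟩

theorem exists_isDisjointLift {P : Finset (List (Fin m ⊕ Fin n))} (hP : S.system.IsCover P)
    (hshare : ¬ S.system.StemsShareInput P) :
    ∃ lift, (S.homogeneousExtension (pathCount P) hP.one_le_pathCount).IsDisjointLift P lift := by
  classical
  set E := S.homogeneousExtension (pathCount P) hP.one_le_pathCount
  let F : Fin n → Finset (List (Fin m ⊕ Fin n)) := fun i => P.filter fun p => Sum.inr i ∈ p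
  have hF : ∀ i, (F i).card = pathCount P i := fun i => by
    unfold pathCount
    congr
  have hmem : ∀ p ∈ P, ∀ i, Sum.inr i ∈ p → p ∈ F i := fun p hp i hi =>
    Finset.mem_filter.2 ⟨hp, hi⟩
  let e : ∀ i, F i ≃ Fin (E.ord i) := fun i => (F i).equivFinOfCardEq (hF i)
  let idx : List (Fin m ⊕ Fin n) → ∀ i, Fin (E.ord i) := fun p i =>
    if h : p ∈ F i then e i ⟨p, h⟩ else ⟨0, E.ord_pos i⟩
  let φ : List (Fin m ⊕ Fin n) → Fin m ⊕ Fin n → Fin m ⊕ E.State := fun p =>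
    Sum.map id fun i => ⟨i, idx p i⟩
  have hφ : ∀ p z, E.proj (φ p z) = z := by
    rintro p (s | i) <;> rfl
  have hinj : ∀ p, Function.Injective (φ p) := fun p => Function.LeftInverse.injective (hφ p)
  have hadj : ∀ p a b, S.system.graph.Adj a b → E.system.graph.Adj (φ p a) (φ p b) := by
    intro p a b hab
    rw [homogeneousExtension_adj]
    change S.system.graph.Adj (E.proj (φ p a)) (E.proj (φ p b))
    rwa [hφ, hφ]
  refine ⟨fun p => p.map (φ p), fun p hp => ⟨?_, fun h => h.map (hinj p) (hadj p) (fun _ => rfl)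
    fun i => ⟨_, rfl⟩, fun h => h.map (hinj p) (hadj p)⟩, fun p hp q hq hne x hxp hxq => ?_,
    fun x => ?_⟩
  · rw [List.map_map]
    conv_rhs => rw [← List.map_id p]
    exact List.map_congr_left fun z _ => hφ p z
  · obtain ⟨a, ha, rfl⟩ := List.mem_map.1 hxp
    obtain ⟨b, hb, hab⟩ := List.mem_map.1 hxq
    obtain rfl : b = a := by rw [← hφ q b, hab, hφ]
    rcases b with s | i
    · have hstem : ∀ r ∈ P, Sum.inl s ∈ r → S.system.IsStem r := fun r hr hs =>
        (hP.1 r hr).resolve_right fun h => h.inl_notMem s hs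
      exact hshare ⟨p, hp, q, hq, hne, hstem p hp ha, hstem q hq hb,
        ((hstem p hp ha).head?_eq ha).trans ((hstem q hq hb).head?_eq hb).symm⟩
    · have h1 : idx q i = idx p i := by simpa [φ] using hab
      simp only [idx, hmem p hp i ha, hmem q hq i hb, dif_pos] at h1
      exact hne (congrArg Subtype.val ((e i).injective h1)).symm
  · obtain ⟨i, k⟩ := x
    obtain ⟨⟨p, hp⟩, hk⟩ := (e i).surjective k
    have hp' := Finset.mem_filter.1 hp
    refine ⟨p, hp'.1, List.mem_map.2 ⟨Sum.inr i, hp'.2, ?_⟩⟩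
    have : idx p i = k := by simp only [idx, hp, dif_pos, hk]
    simp [φ, this]

theorem Extension.structurallyControllable_of_injective {E : S.Extension}
    {A : Matrix E.State E.State ℝ} {B : Matrix E.State (Fin m) ℝ}
    (hreal : E.system.IsRealization A B)
    (hinj : Function.Injective fun w : E.State → ℝ => w ᵥ* ctrbMatrix A B) :
    E.system.StructurallyControllable ∧ E.StructurallyOutputControllable := by
  refine ⟨⟨A, B, hreal, (vecMul_injective_iff.1 hinj).rank_matrix⟩,
    A, B, fun _ _ => 1, hreal, fun _ _ _ => rfl, ?_⟩
  -- All-ones output rows are admissible for every order, and independent because their supports are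
  -- disjoint and nonempty.
  have hC : Function.Injective fun v : Fin n → ℝ => v ᵥ* E.outputMatrix fun _ _ => 1 := by
    intro v w hvw
    ext i
    have := congrFun hvw ⟨i, ⟨0, E.ord_pos i⟩⟩
    simpa [vecMul, dotProduct, Extension.outputMatrix] using this
  have hR : Function.Injective fun v : Fin n → ℝ =>
      v ᵥ* ((E.outputMatrix fun _ _ => 1) * ctrbMatrix A B) := by
    simp only [← vecMul_vecMul]
    exact hinj.comp hC
  simpa using (vecMul_injective_iff.1 hR).rank_matrix

end NetworkSystem

/-- Every X-network has a structurally (output) controllable extended system with homogeneous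
internal dynamics. Moreover, for every admissible cover `P`, giving each subsystem one state per
path of `P` through it, and keeping exactly the original interconnections, yields such a system, in
whose graph the cover `P` becomes vertex-disjoint. -/
theorem theorem2 {n m : ℕ} (S : NetworkSystem n m) (hS : S.IsXNetwork) :
    (∃ E : S.Extension, E.IsHomogeneous ∧ E.system.StructurallyControllable ∧
      E.StructurallyOutputControllable) ∧
    ∀ P : Finset (List (Fin m ⊕ Fin n)), S.system.IsXCover P →
      ∃ E : S.Extension, E.IsHomogeneous ∧
        (∀ i, E.ord i = StructuredSystem.pathCount P i) ∧
        (∀ i j, E.link i j ↔ S.link i j) ∧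
        (∀ i s, E.input i s ↔ S.input i s) ∧
        (∃ lift, E.IsDisjointLift P lift) ∧
        E.system.StructurallyControllable ∧
        E.StructurallyOutputControllable := by
  obtain ⟨hacc, -, P₀, hP₀⟩ := hS
  suffices hall : ∀ P : Finset (List (Fin m ⊕ Fin n)), S.system.IsXCover P →
      ∃ E : S.Extension, E.IsHomogeneous ∧
        (∀ i, E.ord i = StructuredSystem.pathCount P i) ∧
        (∀ i j, E.link i j ↔ S.link i j) ∧
        (∀ i s, E.input i s ↔ S.input i s) ∧
        (∃ lift, E.IsDisjointLift P lift) ∧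
        E.system.StructurallyControllable ∧
        E.StructurallyOutputControllable by
    obtain ⟨E, hE, -, -, -, -, hc⟩ := hall P₀ hP₀
    exact ⟨⟨E, hE, hc⟩, hall⟩
  rintro P ⟨hcov, -, hshare⟩
  obtain ⟨lift, hlift⟩ := NetworkSystem.exists_isDisjointLift hcov hshare
  refine ⟨_, fun _ => id, fun _ => rfl, fun _ _ => Iff.rfl, fun _ _ => Iff.rfl, ⟨lift, hlift⟩, ?_⟩
  obtain ⟨π, hπ, hadj⟩ := StructuredSystem.exists_injective_pred (lift '' P)
    (by
      rintro _ ⟨p, hp, rfl⟩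
      exact (hcov.1 p hp).imp (hlift.1 p hp).2.1 (hlift.1 p hp).2.2)
    (by
      rintro _ ⟨p, hp, rfl⟩ _ ⟨q, hq, rfl⟩ hne
      exact hlift.2.1 p hp q hq fun h => hne (h ▸ rfl))
    (fun x => by
      obtain ⟨p, hp, hx⟩ := hlift.2.2 x
      exact ⟨_, ⟨p, hp, rfl⟩, hx⟩)
  obtain ⟨A, B, hreal, hinj⟩ := StructuredSystem.exists_vecMul_ctrbMatrix_injective _ π hπ hadj
    fun R => NetworkSystem.homogeneousExtension_closed_eq_univ hacc R
  exact NetworkSystem.Extension.structurallyControllable_of_injective hreal hinj
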